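/- \textbf{Dyck paths.} A Dyck path of semi-length $n$ is a word in $\{U,D\}^{2n}$ with $n$ letters $U$ and $n$ letters $D$, every initial segment of which has at least as many $U$'s as $D$'s. A \emph{long ascent} is a maximal run of $U$'s of length at least $2$; a \emph{singleton} is a maximal run of $U$'s of length $1$. For integers $n,\ell\ge 0$ and $s\in\mathbb Z$, let $\operatorname{Dyck}(n,\ell,s)$ be the set of Dyck paths of semi-length $n$ with exactly $\ell$ long ascents and exactly $s$ singletons such that no singleton appears after the last long ascent, i.e. such that every singleton is followed somewhere to its right by a long ascent (in particular, there is no singleton if there is no long ascent). The set is empty if $s<0$. \textbf{Triangulations.} Label the vertices of an $n$-gon ($n\ge 3$) by $1,\dots,n$ in counter-clockwise order. A triangulation $T$ is a set of $n-3$ chords between non-adjacent vertices, no two of which intersect in the interior of the polygon. Its sequence of fans $\mathcal F(T)$ is defined recursively, also for the triangulated polygons with fewer vertices arising in the recursion (with the induced labels): if $T$ is just an edge, $\mathcal F(T)$ is the empty sequence. Otherwise let $F$ be the set of all triangles of $T$ containing the vertex of smallest label (the fan at that vertex); deleting this vertex and all edges incident with it leaves a sequence of triangulated polygons (possibly single edges)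 $T_1,\dots,T_k$, arranged in counter-clockwise order, consecutive ones sharing one vertex, and $\mathcal F(T)=(F,\mathcal F(T_1),\dots,\mathcal F(T_k))$. A fan is \emph{singular} if it consists of one triangle. For integers $n,t\ge 0$ and $s\in\mathbb Z$, let $\operatorname{Tri}(n,t,s)$ be the set of triangulations $T$ of the $n$-gon such that $\mathcal F(T)$ consists of $s+t$ fans, exactly $s$ of them are singular, and the last fan is not singular. The set is empty if $s<0$ or $n<3$. \textbf{Corollary.} \begin{enumerate} \item For all nonnegative integers $n,\ell,s$, \[\#\operatorname{Dyck}(n,\ell,s)=\#\operatorname{Dyck}(n,\ell,n-s-2\ell).\] \item For all nonnegative integers $n,t,s$, \[\#\operatorname{Tri}(n,t,s)=\#\operatorname{Tri}(n,t,n-2t-s-2).\] \end{enumerate} -/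

import Mathlib

/-! ### Dyck paths -/

/-- The lengths of the maximal ascents (maximal runs of up-steps) of a Dyck path, listed from left
to right: cut the word at its down-steps and keep the non-empty blocks of up-steps. -/
def ascents (p : DyckWord) : List ℕ :=
  ((p.toList.splitOn DyckStep.D).map List.length).filter (fun k => 0 < k)

/-- `Dyck n l s`: the Dyck paths of semi-length `n` with `l` long ascents (maximal ascents of length
at least `2`) and `s` singletons (maximal ascents of length `1`) such that no singleton appears
after the last long ascent. The last condition is written as: every singleton is followed, somewhere
to its right, by a long ascent. (So it says that there is no singleton when there is no long ascent.)

The index `s` is an integer so that the set is empty when `s` is negative. -/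
def Dyck (n l : ℕ) (s : ℤ) : Set DyckWord :=
  {p | p.semilength = n ∧
    (ascents p).countP (fun k => 2 ≤ k) = l ∧
    ((ascents p).count 1 : ℤ) = s ∧
    ∀ L R : List ℕ, ascents p = L ++ 1 :: R → ∃ k ∈ R, 2 ≤ k}

/-! ### Triangulations

The vertices of the `n`-gon are labeled `1, …, n` in counter-clockwise order. A side or chord
joining the vertices `i < j` is recorded as the pair `(i, j)`. -/

/-- `(i, j)` is a chord of the `n`-gon joining two non-adjacent vertices `i < j`. -/
def IsDiagonal (n : ℕ) (e : ℕ × ℕ) : Prop :=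
  1 ≤ e.1 ∧ e.1 + 2 ≤ e.2 ∧ e.2 ≤ n ∧ e ≠ (1, n)

/-- The chords `e` and `f` intersect in the interior of the polygon, `e` being the one with the
smaller first endpoint: exactly one endpoint of `f` lies strictly between those of `e`, and the
other one lies strictly outside. -/
def Crosses (e f : ℕ × ℕ) : Prop :=
  e.1 < f.1 ∧ f.1 < e.2 ∧ e.2 < f.2

/-- `D` is the set of chords of a triangulation of the `n`-gon: `n - 3` chords between non-adjacent
vertices, no two of which intersect in the interior of the polygon. -/
def IsTriangulation (n : ℕ) (D : Finset (ℕ × ℕ)) : Prop :=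
  3 ≤ n ∧ (∀ e ∈ D, IsDiagonal n e) ∧ (∀ e ∈ D, ∀ f ∈ D, ¬ Crosses e f) ∧ D.card = n - 3

/-- All edges of the triangulated `n`-gon: the chords in `D`, the sides `(i, i + 1)`, and the
side `(1, n)`. -/
def edges (n : ℕ) (D : Finset (ℕ × ℕ)) : Finset (ℕ × ℕ) :=
  D ∪ (Finset.Ico 1 n).image (fun i => (i, i + 1)) ∪ {(1, n)}

/-- The fan at `a` in the part of the triangulation (with edge set `E`) that lies on the vertices
`a, a + 1, …, b`: the list of all triangles with vertices `a < y < z ≤ b`. The triangle `a y z` is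
recorded as its side `(y, z)` opposite to the origin `a`. The triangles are listed in lexicographic
order of `(y, z)`, that is, counter-clockwise. -/
def fan (E : Finset (ℕ × ℕ)) (a b : ℕ) : List (ℕ × ℕ) :=
  ((List.range' (a + 1) (b - a)) ×ˢ (List.range' (a + 1) (b - a))).filter
    (fun p => p.1 < p.2 ∧ (a, p.1) ∈ E ∧ (p.1, p.2) ∈ E ∧ (a, p.2) ∈ E)

theorem fan_side_lt {E : Finset (ℕ × ℕ)} {a b : ℕ} {p : ℕ × ℕ} (hp : p ∈ fan E a b) :
    p.2 - p.1 < b - a := by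
  obtain ⟨y, z⟩ := p
  rw [fan, List.mem_filter, List.mem_product, List.mem_range'_1, List.mem_range'_1] at hp
  omega

/-- The sequence of fans of the part of the triangulation that lies on the vertices
`a, a + 1, …, b`, where `(a, b)` is an edge. It is empty if this part is just an edge. Otherwise its
first entry is the fan at the smallest vertex `a`. Deleting `a` and the edges at `a` leaves, in
counter-clockwise order, one (possibly degenerate) triangulated polygon on the vertices `y, …, z`
for each side `(y, z)` opposite to `a` in a triangle of that fan; their sequences of fans follow in
this order. -/
def fanSeq (E : Finset (ℕ × ℕ)) (a b : ℕ) : List (List (ℕ × ℕ)) :=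
  if b ≤ a + 1 then []
  else fan E a b :: (fan E a b).attach.flatMap (fun p => fanSeq E p.1.1 p.1.2)
termination_by b - a
decreasing_by exact fan_side_lt p.2

/-- The sequence of fans `ℱ(T)` of the triangulation `T` of the `n`-gon with chord set `D`. -/
def fanDecomposition (n : ℕ) (D : Finset (ℕ × ℕ)) : List (List (ℕ × ℕ)) :=
  fanSeq (edges n D) 1 n

/-- `Tri n t s`: the triangulations `T` of the `n`-gon such that `ℱ(T)` has `s + t` fans, precisely
`s` of them are singular (consist of one triangle), and the last fan is not singular.

The index `s` is an integer so that the set is empty when `s` is negative. -/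
def Tri (n t : ℕ) (s : ℤ) : Set (Finset (ℕ × ℕ)) :=
  {D | IsTriangulation n D ∧
    ((fanDecomposition n D).length : ℤ) = s + t ∧
    ((fanDecomposition n D).countP (fun F => F.length = 1) : ℤ) = s ∧
    ∃ F, (fanDecomposition n D).getLast? = some F ∧ F.length ≠ 1}

/-! Dyck paths and triangulations are both encoded by binary trees: a nonempty path is `U p D q`,
and the triangle at the side `(1, n)` cuts the polygon into a left and a right part. In both models
the root lengthens the first run of the left part by one and then appends the runs of the right
part. Hence ascent lengths and fan sizes are the same list `runs t` (`ascents_ofTree`,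
`map_length_fanSeq`), and both claims reduce to `encard_longTrees_symm`, with `n - 2` nodes for the
`n`-gon.

Give a long run `k` the excess `k - 2`. By `count_add_excess` the number `n - s - 2 * l` is the
total excess, so the claim says that, for a fixed number of long runs, singletons and total excess
have a symmetric joint distribution on trees whose last run is long. This is shown by generating
functions rather than by a bijection. Let `y` mark singletons, `z` long runs and `w` units of
excess. Splitting at the root gives a system of four equations; elimination leaves one quadratic for
the series, and it is symmetric in `y` and `w` (`treeSeries_longWeight_quadratic`). That quadratic
has only one solution with zero constant term, so the series itself is symmetric
(`treeSeries_longWeight_symm`). -/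

/-! ### Run lengths of a binary tree -/

/-- Increase the first entry of a list by one; the empty list becomes `[1]`. -/
def bump : List ℕ → List ℕ
  | [] => [1]
  | a :: as => (a + 1) :: as

@[simp] theorem bump_nil : bump [] = [1] := rfl

/-- The sequence of ascent lengths of the Dyck path, or of fan sizes of the triangulation,
which corresponds to a binary tree. -/
def runs : BinaryTree Unit → List ℕ
  | .nil => []
  | .node _ l r => bump (runs l) ++ runs r

@[simp] theorem runs_nil : runs .nil = [] := rfl

/-- The last entry of a list exists and is at least `2`. -/
def EndsLong (as : List ℕ) : Prop := ∃ k ∈ as.getLast?, 2 ≤ k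

instance : DecidablePred EndsLong := fun as => by
  unfold EndsLong
  cases as.getLast? with
  | none => exact isFalse (by simp)
  | some k => exact decidable_of_iff (2 ≤ k) (by simp)

theorem bump_append {as : List ℕ} (h : as ≠ []) (bs : List ℕ) :
    bump (as ++ bs) = bump as ++ bs := by
  cases as with
  | nil => exact absurd rfl h
  | cons a as => rfl

theorem bump_ne_nil (as : List ℕ) : bump as ≠ [] := by
  cases as <;> simp [bump]

theorem sum_bump (as : List ℕ) : (bump as).sum = as.sum + 1 := by
  cases as <;> simp [bump]; omega

theorem runs_pos (t : BinaryTree Unit) : ∀ k ∈ runs t, 0 < k := by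
  induction t with
  | nil => simp [runs]
  | node v l r hl hr =>
    intro k hk
    rw [runs, List.mem_append] at hk
    rcases hk with hk | hk
    · cases h : runs l with
      | nil => simp [h, bump] at hk; omega
      | cons a as =>
        rw [h] at hk hl
        simp only [bump, List.mem_cons] at hk
        rcases hk with rfl | hk
        · omega
        · exact hl k (by simp [hk])
    · exact hr k hk

theorem sum_runs (t : BinaryTree Unit) : (runs t).sum = t.numNodes := by
  induction t with
  | nil => rfl
  | node v l r hl hr =>
    rw [runs, List.sum_append, sum_bump, hl, hr, BinaryTree.numNodes]; omega

theorem runs_eq_nil {t : BinaryTree Unit} : runs t = [] ↔ t = .nil := by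
  cases t with
  | nil => simp [runs]
  | node v l r => simp [runs, bump_ne_nil]

theorem endsLong_append {as bs : List ℕ} (h : bs ≠ []) :
    EndsLong (as ++ bs) ↔ EndsLong bs := by
  rw [EndsLong, EndsLong, List.getLast?_append_of_ne_nil _ h]

/-- After one bump of a nonempty list its first entry is already long, so a second bump changes
nothing. The empty list is a true exception: `[1]` becomes `[2]`. -/
theorem endsLong_bump_bump (as : List ℕ) (ha : as ≠ []) (hp : ∀ k ∈ as, 0 < k) :
    EndsLong (bump (bump as)) ↔ EndsLong (bump as) := by
  cases as with
  | nil => exact absurd rfl ha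
  | cons a as =>
    have := hp a (by simp)
    cases as with
    | nil => simp [EndsLong, bump]; omega
    | cons b bs =>
      simp only [bump]
      rw [← List.singleton_append, endsLong_append (by simp),
        ← List.singleton_append (x := a + 1), endsLong_append (by simp)]

/-- Only the last entry matters: if it is a singleton nothing follows it, and if it is long it
follows every singleton. -/
theorem singletons_followed_iff {as : List ℕ} (hp : ∀ k ∈ as, 0 < k) :
    (∀ L R : List ℕ, as = L ++ 1 :: R → ∃ k ∈ R, 2 ≤ k) ↔ as = [] ∨ EndsLong as := by
  constructor
  · intro h
    rcases List.eq_nil_or_concat as with rfl | ⟨bs, b, rfl⟩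
    · exact Or.inl rfl
    · right
      refine ⟨b, by simp, ?_⟩
      by_contra hb
      have h0 := hp b (by simp)
      obtain rfl : b = 1 := by omega
      simpa using h bs [] (by simp)
  · rintro (rfl | ⟨k, hk, h2⟩) L R hLR
    · simp at hLR
    · rw [hLR, Option.mem_def, List.getLast?_append_of_ne_nil _ (by simp)] at hk
      cases R with
      | nil => simp at hk; omega
      | cons c cs =>
        rw [List.getLast?_cons_cons] at hk
        exact ⟨k, List.mem_of_getLast? hk, h2⟩

/-! ### Weights -/

section Weights

variable {R : Type*} [CommRing R] (y z w : R)

/-- The weight of an entry: `y` for a singleton and `z * w ^ e` for the long entry `e + 2`. -/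
def letterWeight (k : ℕ) : R := if k = 1 then y else z * w ^ (k - 2)

/-- The weight of a list of run lengths. -/
def listWeight (as : List ℕ) : R := (as.map (letterWeight y z w)).prod

/-- The weight of a list of run lengths that ends with a long run. -/
def longWeight (as : List ℕ) : R := if EndsLong as then listWeight y z w as else 0

/-- The indicator of the empty tree. -/
def nilWeight (R : Type*) [CommRing R] (t : BinaryTree Unit) : R := if t = .nil then 1 else 0

@[simp] theorem listWeight_nil : listWeight y z w [] = 1 := rfl

@[simp] theorem listWeight_one : listWeight y z w [1] = y := by simp [listWeight, letterWeight]

@[simp] theorem longWeight_nil : longWeight y z w [] = 0 := by simp [longWeight, EndsLong]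

@[simp] theorem longWeight_one : longWeight y z w [1] = 0 := by simp [longWeight, EndsLong]

theorem listWeight_append (as bs : List ℕ) :
    listWeight y z w (as ++ bs) = listWeight y z w as * listWeight y z w bs := by
  simp [listWeight]

theorem letterWeight_add_two {k : ℕ} (hk : 0 < k) :
    letterWeight y z w (k + 2) = w * letterWeight y z w (k + 1) := by
  obtain ⟨j, rfl⟩ : ∃ j, k = j + 1 := ⟨k - 1, by omega⟩
  simp [letterWeight, pow_succ]; ring

/-- Bumping a long entry costs a factor `w`. The only other case is `[1]` turning into `[2]`, where
`y` becomes `z`; the `nilWeight` term corrects for it. -/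
theorem listWeight_bump_bump_runs (t : BinaryTree Unit) :
    listWeight y z w (bump (bump (runs t))) =
      w * listWeight y z w (bump (runs t)) + nilWeight R t * (z - w * y) := by
  cases h : runs t with
  | nil =>
    rw [runs_eq_nil] at h
    simp [h, bump, listWeight, letterWeight, nilWeight]
  | cons a as =>
    have ht : t ≠ .nil := fun h' => by simp [h'] at h
    have ha : 0 < a := runs_pos t a (by simp [h])
    simp [bump, listWeight, letterWeight_add_two y z w ha, nilWeight, ht, mul_assoc]

theorem longWeight_append_runs (as : List ℕ) (t : BinaryTree Unit) :
    longWeight y z w (as ++ runs t) =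
      listWeight y z w as * longWeight y z w (runs t) + longWeight y z w as * nilWeight R t := by
  by_cases h : t = .nil
  · simp [h, nilWeight, longWeight, EndsLong]
  · have h' : runs t ≠ [] := by rwa [Ne, runs_eq_nil]
    simp [longWeight, endsLong_append h', nilWeight, h, listWeight_append]

theorem longWeight_bump_bump_runs (t : BinaryTree Unit) :
    longWeight y z w (bump (bump (runs t))) =
      w * longWeight y z w (bump (runs t)) + nilWeight R t * z := by
  by_cases h : t = .nil
  · simp [h, bump, longWeight, EndsLong, listWeight, letterWeight, nilWeight]
  · have h' : runs t ≠ [] := by rwa [Ne, runs_eq_nil]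
    simp [longWeight, endsLong_bump_bump _ h' (runs_pos t), listWeight_bump_bump_runs, nilWeight, h]

/-! ### Generating functions and the symmetric quadratic equation -/

/-- The generating function of a weight on binary trees, by number of nodes. -/
noncomputable def treeSeries (φ : BinaryTree Unit → R) : PowerSeries R :=
  PowerSeries.mk fun n => ∑ t ∈ BinaryTree.treesOfNumNodesEq n, φ t

theorem sum_treesOfNumNodesEq_succ (φ : BinaryTree Unit → R) (n : ℕ) :
    ∑ t ∈ BinaryTree.treesOfNumNodesEq (n + 1), φ t =
      ∑ ij ∈ Finset.HasAntidiagonal.antidiagonal n, ∑ l ∈ BinaryTree.treesOfNumNodesEq ij.1,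
        ∑ r ∈ BinaryTree.treesOfNumNodesEq ij.2, φ (.node () l r) := by
  rw [BinaryTree.treesOfNumNodesEq_succ, Finset.sum_biUnion]
  · refine Finset.sum_congr rfl fun ij _ => ?_
    rw [Finset.sum_map, Finset.sum_product]
    rfl
  · intro a ha b hb hab
    rw [Function.onFun, Finset.disjoint_left]
    intro t ht ht'
    simp only [Finset.mem_map, Finset.mem_product, BinaryTree.mem_treesOfNumNodesEq]
      at ht ht'
    obtain ⟨⟨l, r⟩, ⟨h1, h2⟩, rfl⟩ := ht
    obtain ⟨⟨l', r'⟩, ⟨h3, h4⟩, h⟩ := ht'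
    obtain ⟨rfl, rfl⟩ : l' = l ∧ r' = r := by simpa using h
    exact hab (Prod.ext (h1.symm.trans h3) (h2.symm.trans h4))

/-- The second product leaves room for the contribution of an empty right subtree, needed when the
last run lies in the left part. -/
theorem treeSeries_eq {φ α β γ δ : BinaryTree Unit → R}
    (h : ∀ l r, φ (.node () l r) = α l * β r + γ l * δ r) :
    treeSeries φ = PowerSeries.C (φ .nil) +
      PowerSeries.X * (treeSeries α * treeSeries β + treeSeries γ * treeSeries δ) := by
  ext n
  cases n with
  | zero => simp [treeSeries]
  | succ n =>
    rw [map_add, PowerSeries.coeff_succ_X_mul, map_add, PowerSeries.coeff_mul,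
      PowerSeries.coeff_mul, PowerSeries.coeff_C, if_neg (by omega), zero_add]
    simp only [treeSeries, PowerSeries.coeff_mk]
    rw [sum_treesOfNumNodesEq_succ, ← Finset.sum_add_distrib]
    refine Finset.sum_congr rfl fun ij _ => ?_
    simp_rw [h, Finset.sum_add_distrib, Finset.sum_mul_sum]

theorem treeSeries_nilWeight : treeSeries (nilWeight R) = 1 := by
  have := treeSeries_eq (φ := nilWeight R) (α := 0) (β := 0) (γ := 0) (δ := 0)
    (by simp [nilWeight])
  have h0 : treeSeries (0 : BinaryTree Unit → R) = 0 := by ext; simp [treeSeries]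
  rw [this, h0]
  simp [nilWeight]

theorem treeSeries_linear (a b : R) (φ ψ : BinaryTree Unit → R) :
    treeSeries (fun t => a * φ t + ψ t * b) =
      PowerSeries.C a * treeSeries φ + treeSeries ψ * PowerSeries.C b := by
  ext n
  simp [treeSeries, Finset.sum_add_distrib, Finset.mul_sum, Finset.sum_mul]

open PowerSeries in
/-- The quadratic equation satisfied by the generating function of the trees whose run lengths end
with a long run. It is symmetric in `y` and `w`. -/
theorem treeSeries_longWeight_quadratic :
    let H := treeSeries fun t => longWeight y z w (runs t)
    let Y : PowerSeries R := X * C y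
    let W : PowerSeries R := X * C w
    let Z : PowerSeries R := X ^ 2 * C z
    H ^ 2 * ((1 - Y - W + W * Y - Z) * (Z - W * Y) - Z) +
      Z * H * (1 - Y - W + 2 * (W * Y) - 2 * Z) = Z ^ 2 := by
  intro H Y W Z
  set G := treeSeries fun t => listWeight y z w (runs t) with hG
  set B := treeSeries fun t => listWeight y z w (bump (runs t)) with hB
  set A := treeSeries fun t => longWeight y z w (bump (runs t)) with hA
  have eG : G = 1 + X * B * G := by
    have := treeSeries_eq (φ := fun t => listWeight y z w (runs t))
      (α := fun t => listWeight y z w (bump (runs t))) (β := fun t => listWeight y z w (runs t))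
      -- This is the zero weight, written in the shape that `treeSeries_linear` rewrites.
      (γ := fun t => 0 * nilWeight R t + nilWeight R t * 0) (δ := nilWeight R)
      (by intro l r; simp [runs, listWeight_append])
    rw [treeSeries_linear] at this
    simpa [← hG, ← hB, mul_assoc] using this
  have eB : B = C y + X * ((C w * B + (C z - C w * C y)) * G) := by
    have := treeSeries_eq (φ := fun t => listWeight y z w (bump (runs t)))
      (α := fun t => w * listWeight y z w (bump (runs t)) + nilWeight R t * (z - w * y))
      (β := fun t => listWeight y z w (runs t))
      (γ := fun t => 0 * nilWeight R t + nilWeight R t * 0) (δ := nilWeight R)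
      (by intro l r
          simp [runs, bump_append (bump_ne_nil _), listWeight_append, listWeight_bump_bump_runs])
    rw [treeSeries_linear, treeSeries_linear, treeSeries_nilWeight] at this
    simpa [← hG, ← hB, mul_assoc] using this
  have eH : H = X * (B * H + A) := by
    have := treeSeries_eq (φ := fun t => longWeight y z w (runs t))
      (α := fun t => listWeight y z w (bump (runs t))) (β := fun t => longWeight y z w (runs t))
      (γ := fun t => longWeight y z w (bump (runs t))) (δ := nilWeight R)
      (by intro l r; simp only [runs, longWeight_append_runs])
    rw [treeSeries_nilWeight] at this
    simpa using this
  have eA : A = X * ((C w * B + (C z - C w * C y)) * H + (C w * A + C z)) := by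
    have := treeSeries_eq (φ := fun t => longWeight y z w (bump (runs t)))
      (α := fun t => w * listWeight y z w (bump (runs t)) + nilWeight R t * (z - w * y))
      (β := fun t => longWeight y z w (runs t))
      (γ := fun t => w * longWeight y z w (bump (runs t)) + nilWeight R t * z) (δ := nilWeight R)
      (by intro l r
          simp only [runs, bump_append (bump_ne_nil _), longWeight_append_runs,
            listWeight_bump_bump_runs, longWeight_bump_bump_runs])
    rw [treeSeries_linear, treeSeries_linear, treeSeries_nilWeight] at this
    simpa using this
  -- `u` is the inverse of `G`; in terms of it the system becomes polynomial, with `B`, `G` and `A`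
  -- eliminated.
  obtain ⟨u, hu⟩ : ∃ u, u = 1 - X * B := ⟨_, rfl⟩
  have hGu : G * u = 1 := by rw [hu]; linear_combination eG
  have hHu : H * u = X * A := by rw [hu]; linear_combination eH
  have hXB : X * B = 1 - u := by rw [hu]; ring
  have hu2 : u ^ 2 = u * (1 - Y + W) - W - Z + W * Y := by
    have e1 : X * B = Y + (W * (X * B) + (Z - W * Y)) * G := by
      simp only [Y, W, Z]; linear_combination X * eB
    rw [hXB] at e1
    linear_combination (-u) * e1 - (W * (1 - u) + (Z - W * Y)) * hGu
  have hA2 : H * u * (u - W + Y) = Z := by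
    have e1 : X * A = (W * (X * B) + (Z - W * Y)) * H + W * (X * A) + Z := by
      simp only [Y, W, Z]; linear_combination X * eA
    rw [hXB, ← hHu] at e1
    linear_combination e1 + H * hu2
  -- Replacing `u ^ 2` cancels the terms in `Y - W`, so `H * u` is affine in `H`. Inserting this
  -- into the quadratic for `u` multiplied by `H ^ 2` removes `u`.
  have hlin : H * u = Z + (W + Z - W * Y) * H := by
    linear_combination hA2 - H * hu2
  have : (H * u) ^ 2 = H * (H * u) * (1 - Y + W) - H ^ 2 * (W + Z - W * Y) := by
    linear_combination H ^ 2 * hu2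
  rw [hlin] at this
  linear_combination -this

open PowerSeries in
-- Both series solve the same quadratic. Subtracting the two equations leaves `(H - H') * (X ^ 2 *
-- K) = 0`, and `K` is nonzero because its constant term is `z`.
theorem treeSeries_longWeight_symm [IsDomain R] (hz : z ≠ 0) :
    treeSeries (fun t => longWeight y z w (runs t)) =
      treeSeries fun t => longWeight w z y (runs t) := by
  have h1 := treeSeries_longWeight_quadratic y z w
  have h2 := treeSeries_longWeight_quadratic w z y
  simp only at h1 h2
  set H := treeSeries (fun t => longWeight y z w (runs t)) with hH
  set H' := treeSeries (fun t => longWeight w z y (runs t)) with hH'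
  have c1 : constantCoeff H = 0 := by
    simp [hH, treeSeries, ← coeff_zero_eq_constantCoeff_apply, runs, longWeight, EndsLong]
  have c2 : constantCoeff H' = 0 := by
    simp [hH', treeSeries, ← coeff_zero_eq_constantCoeff_apply, runs, longWeight, EndsLong]
  set K : PowerSeries R :=
    (H + H') * ((1 - X * C y - X * C w + X ^ 2 * (C w * C y) - X ^ 2 * C z) * (C z - C w * C y)
      - C z) + C z * (1 - X * C y - X * C w + 2 * (X ^ 2 * (C w * C y)) - 2 * (X ^ 2 * C z))
    with hK
  have hprod : (H - H') * (X ^ 2 * K) = 0 := by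
    rw [hK]; linear_combination h1 - h2
  have hKne : K ≠ 0 := by
    intro h0
    have := congrArg constantCoeff h0
    simp [hK, c1, c2] at this
    exact hz this
  rcases mul_eq_zero.mp hprod with h | h
  · exact sub_eq_zero.mp h
  · rcases mul_eq_zero.mp h with h | h
    · exact absurd h (pow_ne_zero _ X_ne_zero)
    · exact absurd h hKne

end Weights

/-! ### The symmetric joint distribution on binary trees -/

/-- The total excess of the long entries of a list over `2`. -/
def excess (as : List ℕ) : ℕ := (as.map (· - 2)).sum

theorem listWeight_eq {R : Type*} [CommRing R] (y z w : R) {as : List ℕ} (hp : ∀ k ∈ as, 0 < k) :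
    listWeight y z w as =
      y ^ as.count 1 * z ^ as.countP (fun k => 2 ≤ k) * w ^ excess as := by
  induction as with
  | nil => simp [excess]
  | cons a as ih =>
    have ha := hp a (by simp)
    have := ih fun k hk => hp k (by simp [hk])
    rw [listWeight] at this ⊢
    rw [List.map_cons, List.prod_cons, this]
    by_cases h : a = 1
    · subst h
      simp [letterWeight, excess]; ring
    · have h2 : 2 ≤ a := by omega
      simp [letterWeight, excess, h, h2]; ring

theorem count_add_excess {as : List ℕ} (hp : ∀ k ∈ as, 0 < k) :
    as.count 1 + 2 * as.countP (fun k => 2 ≤ k) + excess as = as.sum := by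
  induction as with
  | nil => simp [excess]
  | cons a as ih =>
    have ha := hp a (by simp)
    have := ih fun k hk => hp k (by simp [hk])
    simp only [excess] at this ⊢
    by_cases h : a = 1
    · subst h
      simp; omega
    · have h2 : 2 ≤ a := by omega
      simp [h, h2]; omega

/-- The exponent vector with entries `a`, `b`, `c`. -/
noncomputable def exponents (a b c : ℕ) : Fin 3 →₀ ℕ :=
  Finsupp.single 0 a + Finsupp.single 1 b + Finsupp.single 2 c

theorem exponents_inj {a b c a' b' c' : ℕ} :
    exponents a b c = exponents a' b' c' ↔ a = a' ∧ b = b' ∧ c = c' := by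
  refine ⟨fun h => ⟨?_, ?_, ?_⟩, by rintro ⟨rfl, rfl, rfl⟩; rfl⟩
  · simpa [exponents] using DFunLike.congr_fun h 0
  · simpa [exponents] using DFunLike.congr_fun h 1
  · simpa [exponents] using DFunLike.congr_fun h 2

open MvPolynomial in
theorem monomial_exponents (a b c : ℕ) :
    (X 0 ^ a * X 1 ^ b * X 2 ^ c : MvPolynomial (Fin 3) ℤ) = monomial (exponents a b c) 1 := by
  simp [X_pow_eq_monomial, monomial_mul, exponents]

open MvPolynomial in
theorem card_longTrees_symm (n l s e : ℕ) :
    ((BinaryTree.treesOfNumNodesEq n).filter fun t => EndsLong (runs t) ∧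
      (runs t).count 1 = s ∧ (runs t).countP (fun k => 2 ≤ k) = l ∧ excess (runs t) = e).card =
    ((BinaryTree.treesOfNumNodesEq n).filter fun t => EndsLong (runs t) ∧
      excess (runs t) = s ∧ (runs t).countP (fun k => 2 ≤ k) = l ∧ (runs t).count 1 = e).card := by
  have h := treeSeries_longWeight_symm (X 0 : MvPolynomial (Fin 3) ℤ) (X 1) (X 2)
    (X_ne_zero (1 : Fin 3))
  have h := congrArg (coeff (exponents s l e)) (congrArg (PowerSeries.coeff n) h)
  simp only [treeSeries, PowerSeries.coeff_mk, coeff_sum] at h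
  rw [Finset.card_filter, Finset.card_filter]
  zify
  convert h using 1
  · refine Finset.sum_congr rfl fun t _ => ?_
    rw [longWeight, listWeight_eq _ _ _ (runs_pos t), monomial_exponents]
    by_cases ht : EndsLong (runs t) <;> simp [ht, coeff_monomial, exponents_inj]
  · refine Finset.sum_congr rfl fun t _ => ?_
    rw [longWeight, listWeight_eq _ _ _ (runs_pos t),
      show ∀ a b c : MvPolynomial (Fin 3) ℤ, a * b * c = c * b * a by intros; ring,
      monomial_exponents]
    by_cases ht : EndsLong (runs t) <;> simp [ht, coeff_monomial, exponents_inj]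

/-- The binary trees with `n` nodes whose run lengths contain `l` long runs and `s` singletons, and
do not end with a singleton. -/
def longTrees (n l : ℕ) (s : ℤ) : Set (BinaryTree Unit) :=
  {t | t.numNodes = n ∧ (runs t).countP (fun k => 2 ≤ k) = l ∧ ((runs t).count 1 : ℤ) = s ∧
    (runs t = [] ∨ EndsLong (runs t))}

theorem encard_longTrees_symm (n l s : ℕ) :
    (longTrees n l (s : ℤ)).encard = (longTrees n l ((n : ℤ) - s - 2 * l)).encard := by
  have key (t : BinaryTree Unit) := sum_runs t ▸ count_add_excess (runs_pos t)
  -- For `n = 0` the only candidate is the empty tree, which is admitted although it does not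
  -- satisfy `EndsLong`; hence the separate case.
  rcases Nat.eq_zero_or_pos n with rfl | hn
  · congr 1
    ext t
    simp only [longTrees, Set.mem_ofPred_eq]
    have := key t
    constructor <;> rintro ⟨h1, h2, h3, h4⟩ <;> refine ⟨h1, h2, ?_, h4⟩ <;> omega
  by_cases hs : s + 2 * l ≤ n
  · obtain ⟨e, rfl⟩ := Nat.exists_eq_add_of_le hs
    have hne (t : BinaryTree Unit) (ht : t.numNodes = s + 2 * l + e) :
        (runs t = [] ∨ EndsLong (runs t)) ↔ EndsLong (runs t) := by
      rw [or_iff_right]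
      rw [runs_eq_nil]
      rintro rfl
      simp at ht; omega
    have h1 : longTrees (s + 2 * l + e) l (s : ℤ) =
        ((BinaryTree.treesOfNumNodesEq (s + 2 * l + e)).filter fun t => EndsLong (runs t) ∧
          (runs t).count 1 = s ∧ (runs t).countP (fun k => 2 ≤ k) = l ∧ excess (runs t) = e) := by
      ext t
      simp only [longTrees, Set.mem_ofPred_eq, Finset.coe_filter, BinaryTree.mem_treesOfNumNodesEq]
      have := key t
      constructor
      · rintro ⟨h1, h2, h3, h4⟩
        exact ⟨h1, (hne t h1).mp h4, by omega, h2, by omega⟩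
      · rintro ⟨h1, h2, h3, h4, h5⟩
        exact ⟨h1, h4, by omega, Or.inr h2⟩
    have h2 : longTrees (s + 2 * l + e) l (((s + 2 * l + e : ℕ) : ℤ) - s - 2 * l) =
        ((BinaryTree.treesOfNumNodesEq (s + 2 * l + e)).filter fun t => EndsLong (runs t) ∧
          excess (runs t) = s ∧ (runs t).countP (fun k => 2 ≤ k) = l ∧ (runs t).count 1 = e) := by
      ext t
      simp only [longTrees, Set.mem_ofPred_eq, Finset.coe_filter, BinaryTree.mem_treesOfNumNodesEq]
      have := key t
      constructor
      · rintro ⟨h1, h2, h3, h4⟩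
        exact ⟨h1, (hne t h1).mp h4, by omega, h2, by omega⟩
      · rintro ⟨h1, h2, h3, h4, h5⟩
        exact ⟨h1, h4, by omega, Or.inr h2⟩
    rw [h1, h2, Set.encard_coe_eq_coe_finsetCard, Set.encard_coe_eq_coe_finsetCard,
      card_longTrees_symm]
  -- Here `s + 2 * l > n`: the left set would need too many nodes, and the index on the right is
  -- negative.
  · congr 1
    ext t
    simp only [longTrees, Set.mem_ofPred_eq]
    have := key t
    constructor <;> rintro ⟨h1, h2, h3, h4⟩ <;> exfalso <;> omega

/-! ### Dyck paths and binary trees -/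

theorem ascents_zero : ascents 0 = [] := by
  simp [ascents, show (0 : DyckWord).toList = [] from rfl]

/-- The lengths of the maximal blocks of up-steps of a word. -/
def wordAscents (p : List DyckStep) : List ℕ :=
  ((p.splitOn DyckStep.D).map List.length).filter (fun k => 0 < k)

theorem wordAscents_append_D (p q : List DyckStep) :
    wordAscents (p ++ DyckStep.D :: q) = wordAscents p ++ wordAscents q := by
  simp [wordAscents, List.splitOn_append_cons_self]

/-- If `p` began with `D`, the new `U` would form a run of its own instead of lengthening the first
one. -/
theorem wordAscents_U_cons (p : List DyckStep) (hp : p = [] ∨ p.head? = some DyckStep.U) :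
    wordAscents (DyckStep.U :: p) = bump (wordAscents p) := by
  rcases hp with rfl | hp
  · simp [wordAscents, List.splitOn_cons_eq_if_modifyHead]
  · obtain ⟨p, rfl⟩ : ∃ q, p = DyckStep.U :: q := by
      cases p with
      | nil => simp at hp
      | cons a q => simp at hp; exact ⟨q, by rw [hp]⟩
    obtain ⟨a, b, hab⟩ := List.exists_cons_of_ne_nil (List.splitOn_ne_nil DyckStep.D p)
    simp [wordAscents, List.splitOn_cons_eq_if_modifyHead, hab, bump]

theorem ascents_nest_add (p q : DyckWord) :
    ascents (p.nest + q) = bump (ascents p) ++ ascents q := by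
  have h : (p.nest + q).toList = (DyckStep.U :: p.toList) ++ DyckStep.D :: q.toList := by
    change ([DyckStep.U] ++ p.toList ++ [DyckStep.D]) ++ q.toList = _
    simp
  change wordAscents _ = bump (wordAscents _) ++ wordAscents _
  rw [h, wordAscents_append_D, wordAscents_U_cons]
  by_cases hp : p = 0
  · exact Or.inl (DyckWord.toList_eq_nil.mpr hp)
  · right
    have hne := DyckWord.toList_ne_nil.mpr hp
    rw [List.head?_eq_some_head hne, DyckWord.head_eq_U]

theorem ascents_ofTree (t : BinaryTree Unit) : ascents (DyckWord.ofTree t) = runs t := by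
  induction t with
  | nil => exact ascents_zero
  | node v l r hl hr => rw [DyckWord.ofTree, ascents_nest_add, hl, hr, runs]

theorem semilength_ofTree (t : BinaryTree Unit) : (DyckWord.ofTree t).semilength = t.numNodes := by
  rw [← DyckWord.numNodes_toTree, DyckWord.toTree_ofTree]

theorem encard_Dyck (n l : ℕ) (s : ℤ) : (Dyck n l s).encard = (longTrees n l s).encard := by
  have : Dyck n l s = DyckWord.equivTree.symm '' longTrees n l s := by
    rw [Equiv.image_eq_preimage_symm]
    ext p
    obtain ⟨t, rfl⟩ := DyckWord.equivTree.symm.surjective p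
    simp only [Dyck, longTrees, Set.mem_ofPred_eq, Set.mem_preimage, Equiv.symm_symm,
      Equiv.apply_symm_apply]
    simp only [DyckWord.equivTree_symm_apply, ascents_ofTree, semilength_ofTree,
      singletons_followed_iff (runs_pos t)]
  rw [this, DyckWord.equivTree.symm.injective.encard_image]

/-! ### Triangulations and binary trees -/

/-- The chords of the triangulation of the polygon on the vertices `a, …, a + t.numNodes + 1`
encoded by `t`, including the chord from the first vertex to the last one. The root of `t` is the
triangle at this chord. -/
def chords : ℕ → BinaryTree Unit → Finset (ℕ × ℕ)
  | _, .nil => ∅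
  | a, .node _ l r => insert (a, a + (l.numNodes + r.numNodes + 1) + 1)
      (chords a l ∪ chords (a + l.numNodes + 1) r)

theorem chords_bounds {a : ℕ} {t : BinaryTree Unit} {e : ℕ × ℕ} (he : e ∈ chords a t) :
    a ≤ e.1 ∧ e.1 + 2 ≤ e.2 ∧ e.2 ≤ a + t.numNodes + 1 := by
  induction t generalizing a with
  | nil => simp [chords] at he
  | node v l r hl hr =>
    simp only [chords, Finset.mem_insert, Finset.mem_union] at he
    simp only [BinaryTree.numNodes]
    rcases he with rfl | he | he
    · dsimp only; omega
    · have := hl he; omega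
    · have := hr he; omega

theorem outer_mem_chords (a : ℕ) {t : BinaryTree Unit} (ht : t.numNodes ≠ 0) :
    (a, a + t.numNodes + 1) ∈ chords a t := by
  cases t with
  | nil => simp at ht
  | node v l r => simp [chords]

theorem mem_chords_left {a : ℕ} {v : Unit} {l r : BinaryTree Unit} {e : ℕ × ℕ} :
    e ∈ chords a l ↔ e ∈ chords a (.node v l r) ∧ e.2 ≤ a + l.numNodes + 1 := by
  simp only [chords, Finset.mem_insert, Finset.mem_union]
  constructor
  · intro h
    exact ⟨Or.inr (Or.inl h), (chords_bounds h).2.2⟩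
  · rintro ⟨rfl | h | h, h2⟩
    · dsimp only at h2; omega
    · exact h
    · have := chords_bounds h; omega

theorem mem_chords_right {a : ℕ} {v : Unit} {l r : BinaryTree Unit} {e : ℕ × ℕ} :
    e ∈ chords (a + l.numNodes + 1) r ↔
      e ∈ chords a (.node v l r) ∧ a + l.numNodes + 1 ≤ e.1 := by
  simp only [chords, Finset.mem_insert, Finset.mem_union]
  constructor
  · intro h
    exact ⟨Or.inr (Or.inr h), (chords_bounds h).1⟩
  · rintro ⟨rfl | h | h, h2⟩
    · dsimp only at h2; omega
    · have := chords_bounds h; omega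
    · exact h

theorem card_chords (a : ℕ) (t : BinaryTree Unit) : (chords a t).card = t.numNodes := by
  induction t generalizing a with
  | nil => rfl
  | node v l r hl hr =>
    rw [chords, Finset.card_insert_of_notMem, Finset.card_union_of_disjoint, hl, hr,
      BinaryTree.numNodes]
    · rw [Finset.disjoint_left]
      intro e h h'
      have := chords_bounds h
      have := chords_bounds h'
      omega
    · rw [Finset.mem_union]
      rintro (h | h) <;> have := chords_bounds h <;> dsimp only at this <;> omega

theorem not_crosses_chords {a : ℕ} {t : BinaryTree Unit} {e f : ℕ × ℕ} (he : e ∈ chords a t)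
    (hf : f ∈ chords a t) : ¬ Crosses e f := by
  induction t generalizing a with
  | nil => simp [chords] at he
  | node v l r hl hr =>
    have be := chords_bounds he
    have bf := chords_bounds hf
    simp only [chords, Finset.mem_insert, Finset.mem_union] at he hf
    simp only [BinaryTree.numNodes] at be bf
    rcases he with rfl | he | he
    · rintro ⟨h1, h2, h3⟩
      dsimp only at *
      omega
    · rcases hf with rfl | hf | hf
      · rintro ⟨h1, h2, h3⟩
        dsimp only at *
        omega
      · exact hl he hf
      · have := chords_bounds he
        have := chords_bounds hf
        rintro ⟨h1, h2, h3⟩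
        omega
    · rcases hf with rfl | hf | hf
      · rintro ⟨h1, h2, h3⟩
        dsimp only at *
        omega
      · have := chords_bounds he
        have := chords_bounds hf
        rintro ⟨h1, h2, h3⟩
        omega
      · exact hr he hf

/-- The apex of the root triangle can be read off the chords: no chord from `a` other than the outer
one reaches beyond it. A larger `l'` would supply such a chord. -/
theorem numNodes_left_le_of_chords_eq {a : ℕ} {v v' : Unit} {l r l' r' : BinaryTree Unit}
    (h : chords a (.node v l r) = chords a (.node v' l' r'))
    (hN : l.numNodes + r.numNodes = l'.numNodes + r'.numNodes) :
    l'.numNodes ≤ l.numNodes := by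
  by_contra! hlt
  have h1 := outer_mem_chords a (t := l') (by omega)
  rw [mem_chords_left (v := v') (r := r'), ← h, chords, Finset.mem_insert, Finset.mem_union] at h1
  obtain ⟨h1 | h1 | h1, -⟩ := h1
  · rw [Prod.mk.injEq] at h1
    omega
  · have := chords_bounds h1; dsimp only at this; omega
  · have := chords_bounds h1; dsimp only at this; omega

theorem chords_injective {a : ℕ} {t t' : BinaryTree Unit} (h : chords a t = chords a t') :
    t = t' := by
  have hN : t.numNodes = t'.numNodes := by rw [← card_chords a, h, card_chords]
  induction t generalizing a t' with
  | nil => cases t' with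
    | nil => rfl
    | node => simp at hN
  | node v l r hl hr =>
    cases t' with
    | nil => simp at hN
    | node v' l' r' =>
      simp only [BinaryTree.numNodes] at hN
      have hle := numNodes_left_le_of_chords_eq h (by omega)
      have hge := numNodes_left_le_of_chords_eq h.symm (by omega)
      have hlN : l.numNodes = l'.numNodes := le_antisymm hge hle
      have e1 : l = l' := by
        refine hl (a := a) ?_ hlN
        ext e
        rw [mem_chords_left (v := v) (r := r), mem_chords_left (v := v') (l := l') (r := r'),
          h, hlN]
      have e2 : r = r' := by
        refine hr (a := a + l.numNodes + 1) ?_ (by omega)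
        ext e
        rw [mem_chords_right (v := v), h, hlN, ← mem_chords_right]
      rw [e1, e2]

/-! ### Every triangulation comes from a tree -/

/-- The apex is the farthest neighbour of `a` short of the outer chord; `k = 0` stands for the side
`(a, a + 1)`, which is not recorded in `D`. -/
theorem exists_apex (N a : ℕ) (hN : 0 < N) (D : Finset (ℕ × ℕ)) :
    ∃ k < N, (k = 0 ∨ (a, a + k + 1) ∈ D) ∧ ∀ j, k < j → j < N → (a, a + j + 1) ∉ D := by
  have hP : (fun k => k = 0 ∨ (a, a + k + 1) ∈ D) 0 := Or.inl rfl
  refine ⟨Nat.findGreatest (fun k => k = 0 ∨ (a, a + k + 1) ∈ D) (N - 1), ?_,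
    Nat.findGreatest_spec (P := fun k => k = 0 ∨ (a, a + k + 1) ∈ D) (Nat.zero_le _) hP, ?_⟩
  · have := Nat.findGreatest_le (P := fun k => k = 0 ∨ (a, a + k + 1) ∈ D) (N - 1)
    omega
  · intro j h1 h2 h3
    exact Nat.findGreatest_is_greatest h1 (by omega) (Or.inr h3)

/-- A set of non-crossing chords on the vertices `a, …, a + N + 1` has at most `N` elements, and
comes from a binary tree if it has `N` elements. -/
theorem noncrossing_card_le_and_exists_tree (N a : ℕ) (D : Finset (ℕ × ℕ))
    (hD : ∀ e ∈ D, a ≤ e.1 ∧ e.1 + 2 ≤ e.2 ∧ e.2 ≤ a + N + 1)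
    (hc : ∀ e ∈ D, ∀ f ∈ D, ¬ Crosses e f) :
    D.card ≤ N ∧ (D.card = N → ∃ t : BinaryTree Unit, t.numNodes = N ∧ chords a t = D) := by
  induction N using Nat.strong_induction_on generalizing a D with
  | _ N ih =>
  rcases Nat.eq_zero_or_pos N with rfl | hN
  · obtain rfl : D = ∅ := Finset.eq_empty_of_forall_notMem fun e he => by
      have := hD e he; omega
    exact ⟨le_rfl, fun _ => ⟨.nil, rfl, rfl⟩⟩
  obtain ⟨k, hk, hk1, hk2⟩ := exists_apex N a hN D
  set D₁ := D.filter fun e => e.2 ≤ a + k + 1 with hD₁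
  set D₂ := D.filter fun e => a + k + 1 ≤ e.1 with hD₂
  -- A chord from `a` past the apex must be the outer one, by the choice of `k`. A chord that starts
  -- strictly between `a` and the apex and ends past it would cross the chord from `a` to the apex.
  have hsub : D ⊆ insert (a, a + N + 1) (D₁ ∪ D₂) := by
    rintro ⟨i, j⟩ he
    have hb := hD _ he
    simp only [hD₁, hD₂, Finset.mem_insert, Finset.mem_union, Finset.mem_filter, he, true_and,
      Prod.mk.injEq]
    dsimp only at hb
    by_contra! hcon
    obtain ⟨h1, h2, h3⟩ := hcon
    rcases Nat.eq_or_lt_of_le hb.1 with rfl | hlt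
    · have := h1 rfl
      obtain ⟨m, rfl⟩ : ∃ m, j = a + m + 1 := ⟨j - a - 1, by omega⟩
      exact hk2 m (by omega) (by omega) he
    · rcases hk1 with rfl | hk1
      · omega
      · exact hc _ hk1 _ he ⟨hlt, h3, h2⟩
  obtain ⟨i1, i1'⟩ := ih k hk a D₁
    (fun e he => by
      rw [hD₁, Finset.mem_filter] at he
      have := hD e he.1; omega)
    (fun e he f hf => hc e (Finset.mem_filter.mp he).1 f (Finset.mem_filter.mp hf).1)
  obtain ⟨i2, i2'⟩ := ih (N - k - 1) (by omega) (a + k + 1) D₂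
    (fun e he => by
      rw [hD₂, Finset.mem_filter] at he
      have := hD e he.1; omega)
    (fun e he f hf => hc e (Finset.mem_filter.mp he).1 f (Finset.mem_filter.mp hf).1)
  have c0 := Finset.card_le_card hsub
  have c1 := Finset.card_insert_le (a, a + N + 1) (D₁ ∪ D₂)
  have c2 := Finset.card_union_le D₁ D₂
  -- The bound is `1 + k + (N - k - 1) = N`; equality forces both halves to be full and the
  -- inclusion `hsub` to be an equality.
  refine ⟨by omega, fun hcard => ?_⟩
  obtain ⟨l, hl, hl'⟩ := i1' (by omega)
  obtain ⟨r, hr, hr'⟩ := i2' (by omega)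
  refine ⟨.node () l r, by simp only [BinaryTree.numNodes]; omega, ?_⟩
  rw [Finset.eq_of_subset_of_card_le hsub (by omega), chords, hl, hl', hr, hr',
    show k + (N - k - 1) + 1 = N by omega]

/-- The chord set of the triangulation of the polygon on `1, …, t.numNodes + 2` encoded by `t`. -/
def diagonals (t : BinaryTree Unit) : Finset (ℕ × ℕ) :=
  (chords 1 t).erase (1, t.numNodes + 2)

theorem insert_diagonals {t : BinaryTree Unit} (ht : t.numNodes ≠ 0) :
    insert (1, t.numNodes + 2) (diagonals t) = chords 1 t :=
  Finset.insert_erase (by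
    have := outer_mem_chords 1 ht
    rwa [show 1 + t.numNodes + 1 = t.numNodes + 2 by omega] at this)

/-- Adding the side `(1, n)`, which crosses nothing, gives `n - 2` noncrossing chords, the extremal
case of `noncrossing_card_le_and_exists_tree`. -/
theorem isTriangulation_iff {n : ℕ} (hn : 3 ≤ n) (D : Finset (ℕ × ℕ)) :
    IsTriangulation n D ↔ ∃ t : BinaryTree Unit, t.numNodes + 2 = n ∧ diagonals t = D := by
  constructor
  · rintro ⟨-, h1, h2, h3⟩
    have hnot : (1, n) ∉ D := fun h => (h1 _ h).2.2.2 rfl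
    have hcard : (insert (1, n) D).card = n - 2 := by
      rw [Finset.card_insert_of_notMem hnot]; omega
    obtain ⟨-, h⟩ := noncrossing_card_le_and_exists_tree (n - 2) 1 (insert (1, n) D)
      (by
        intro e he
        rcases Finset.mem_insert.mp he with rfl | he
        · dsimp only; omega
        · have := h1 e he
          exact ⟨this.1, this.2.1, by have := this.2.2.1; omega⟩)
      (by
        intro e he f hf
        rcases Finset.mem_insert.mp he with rfl | he
        · rcases Finset.mem_insert.mp hf with rfl | hf
          · rintro ⟨h1, -, -⟩; omega
          · have := (h1 f hf).2.2.1
            rintro ⟨-, -, h⟩; dsimp only at h; omega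
        · rcases Finset.mem_insert.mp hf with rfl | hf
          · have := (h1 e he).1
            rintro ⟨h, -, -⟩; dsimp only at h; omega
          · exact h2 e he f hf)
    replace h := h hcard
    obtain ⟨t, ht, ht'⟩ := h
    refine ⟨t, by omega, ?_⟩
    rw [diagonals, ht', show t.numNodes + 2 = n by omega, Finset.erase_insert hnot]
  · rintro ⟨t, rfl, rfl⟩
    have ht : t.numNodes ≠ 0 := by omega
    refine ⟨hn, fun e he => ?_, fun e he f hf => ?_, ?_⟩
    · rw [diagonals, Finset.mem_erase] at he
      have := chords_bounds he.2
      exact ⟨this.1, this.2.1, by omega, he.1⟩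
    · exact not_crosses_chords (Finset.mem_of_mem_erase he) (Finset.mem_of_mem_erase hf)
    · have := congrArg Finset.card (insert_diagonals ht)
      rw [card_chords, Finset.card_insert_of_notMem (by simp [diagonals])] at this
      omega

theorem diagonals_injOn (N : ℕ) (hN : N ≠ 0) : Set.InjOn diagonals {t | t.numNodes = N} := by
  intro t ht t' ht' h
  rw [Set.mem_ofPred_eq] at ht ht'
  apply chords_injective (a := 1)
  rw [← insert_diagonals (t := t) (by omega), ← insert_diagonals (t := t') (by omega), h, ht, ht']

/-! ### The sequence of fans -/

/-- On the vertices `a, …, a + t.numNodes + 1`, the edge set `E` consists of the sides and of the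
chords encoded by `t`. -/
def Represents (E : Finset (ℕ × ℕ)) (a : ℕ) (t : BinaryTree Unit) : Prop :=
  ∀ i j, a ≤ i → i < j → j ≤ a + t.numNodes + 1 → ((i, j) ∈ E ↔ j = i + 1 ∨ (i, j) ∈ chords a t)

theorem Represents.left {E : Finset (ℕ × ℕ)} {a : ℕ} {v : Unit} {l r : BinaryTree Unit}
    (h : Represents E a (.node v l r)) : Represents E a l := by
  intro i j h1 h2 h3
  rw [h i j h1 h2 (by simp only [BinaryTree.numNodes]; omega),
    mem_chords_left (v := v) (l := l) (r := r)]
  simp [h3]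

theorem Represents.right {E : Finset (ℕ × ℕ)} {a : ℕ} {v : Unit} {l r : BinaryTree Unit}
    (h : Represents E a (.node v l r)) : Represents E (a + l.numNodes + 1) r := by
  intro i j h1 h2 h3
  rw [h i j (by omega) h2 (by simp only [BinaryTree.numNodes]; omega), mem_chords_right (v := v)]
  simp [h1]

theorem represents_edges {t : BinaryTree Unit} (ht : t.numNodes ≠ 0) :
    Represents (edges (t.numNodes + 2) (diagonals t)) 1 t := by
  intro i j h1 h2 h3
  rw [← insert_diagonals ht]
  simp only [edges, Finset.mem_union, Finset.mem_image, Finset.mem_Ico, Finset.mem_singleton,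
    Finset.mem_insert, Prod.mk.injEq]
  constructor
  · rintro ((h | ⟨x, hx, rfl, rfl⟩) | h)
    · exact Or.inr (Or.inr h)
    · exact Or.inl rfl
    · exact Or.inr (Or.inl h)
  · rintro (h | h | h)
    · exact Or.inl (Or.inr ⟨i, by omega, rfl, h.symm⟩)
    · exact Or.inr h
    · exact Or.inl (Or.inl h)

theorem mem_fan {E : Finset (ℕ × ℕ)} {a b : ℕ} {p : ℕ × ℕ} :
    p ∈ fan E a b ↔ a < p.1 ∧ p.1 < p.2 ∧ p.2 ≤ b ∧
      (a, p.1) ∈ E ∧ (p.1, p.2) ∈ E ∧ (a, p.2) ∈ E := by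
  obtain ⟨y, z⟩ := p
  rw [fan, List.mem_filter, List.mem_product, List.mem_range'_1, List.mem_range'_1]
  simp only [decide_eq_true_eq]
  constructor
  · rintro ⟨h1, h2, h3⟩
    exact ⟨by omega, h2, by omega, h3⟩
  · rintro ⟨h1, h2, h3, h4⟩
    exact ⟨by omega, h2, h4⟩

theorem fan_pairwise (E : Finset (ℕ × ℕ)) (a b : ℕ) :
    (fan E a b).Pairwise fun p q => p.1 < q.1 ∨ p.1 = q.1 ∧ p.2 < q.2 := by
  apply List.Pairwise.filter
  change List.Pairwise _ (List.flatMap _ _)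
  rw [List.pairwise_flatMap]
  constructor
  · intro x _
    rw [List.pairwise_map]
    exact (List.pairwise_lt_range' (step := 1)).imp fun h => Or.inr ⟨rfl, h⟩
  · refine (List.pairwise_lt_range' (step := 1)).imp fun h p hp q hq => ?_
    obtain ⟨_, _, rfl⟩ := List.mem_map.mp hp
    obtain ⟨_, _, rfl⟩ := List.mem_map.mp hq
    exact Or.inl h

/-- Fans are lexicographically sorted lists, so comparing them reduces to comparing members. -/
theorem eq_of_pairwise_lex {P Q : List (ℕ × ℕ)}
    (hP : P.Pairwise fun p q => p.1 < q.1 ∨ p.1 = q.1 ∧ p.2 < q.2)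
    (hQ : Q.Pairwise fun p q => p.1 < q.1 ∨ p.1 = q.1 ∧ p.2 < q.2)
    (h : ∀ p, p ∈ P ↔ p ∈ Q) : P = Q := by
  refine List.Perm.eq_of_pairwise (fun p q _ _ h1 h2 => by omega) hP hQ ?_
  refine (List.perm_ext_iff_of_nodup (hP.imp ?_) (hQ.imp ?_)).mpr h <;>
  · rintro p q h rfl
    omega

/-- The left polygon has the same smallest vertex `a`, so its fan consists of all triangles at `a`
except the root triangle, which comes last. This is the source of `bump`. -/
theorem fan_node {E : Finset (ℕ × ℕ)} {a : ℕ} {v : Unit} {l r : BinaryTree Unit}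
    (h : Represents E a (.node v l r)) :
    fan E a (a + (l.numNodes + r.numNodes + 1) + 1) =
      fan E a (a + l.numNodes + 1) ++
        [(a + l.numNodes + 1, a + (l.numNodes + r.numNodes + 1) + 1)] := by
  have first (z : ℕ) (hz : a < z) (hz' : z ≤ a + (l.numNodes + r.numNodes + 1) + 1)
      (hE : (a, z) ∈ E) :
      z ≤ a + l.numNodes + 1 ∨ z = a + (l.numNodes + r.numNodes + 1) + 1 := by
    rw [h a z le_rfl hz (by simpa using hz')] at hE
    rcases hE with rfl | hE
    · omega
    · simp only [chords, Finset.mem_insert, Finset.mem_union, Prod.mk.injEq] at hE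
      rcases hE with hE | hE | hE
      · exact Or.inr hE.2
      · exact Or.inl (chords_bounds hE).2.2
      · have := chords_bounds hE
        dsimp only at this; omega
  have last (y : ℕ) (hy : a < y) (hy' : y < a + (l.numNodes + r.numNodes + 1) + 1)
      (hE : (y, a + (l.numNodes + r.numNodes + 1) + 1) ∈ E) : a + l.numNodes + 1 ≤ y := by
    rw [h y _ hy.le hy' (by simp)] at hE
    rcases hE with hE | hE
    · omega
    · simp only [chords, Finset.mem_insert, Finset.mem_union, Prod.mk.injEq] at hE
      rcases hE with hE | hE | hE
      · omega
      · have := chords_bounds hE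
        dsimp only at this; omega
      · exact (chords_bounds hE).1
  have side (a : ℕ) (t : BinaryTree Unit) (h : Represents E a t) :
      (a, a + t.numNodes + 1) ∈ E := by
    rw [h _ _ le_rfl (by omega) le_rfl]
    by_cases ht : t.numNodes = 0
    · simp [ht]
    · exact Or.inr (outer_mem_chords a ht)
  apply eq_of_pairwise_lex (fan_pairwise _ _ _)
  · rw [List.pairwise_append]
    refine ⟨fan_pairwise _ _ _, List.pairwise_singleton _ _, fun p hp q hq => ?_⟩
    rw [List.mem_singleton] at hq
    rw [mem_fan] at hp
    subst hq
    dsimp only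
    omega
  · rintro ⟨y, z⟩
    rw [List.mem_append, List.mem_singleton, mem_fan, mem_fan, Prod.mk.injEq]
    dsimp only
    constructor
    · rintro ⟨h1, h2, h3, h4, h5, h6⟩
      rcases first z (by omega) h3 h6 with hz | rfl
      · exact Or.inl ⟨h1, h2, hz, h4, h5, h6⟩
      · rcases first y h1 h2.le h4 with hy | rfl
        · exact Or.inr ⟨le_antisymm hy (last y h1 h2 h5), rfl⟩
        · omega
    · rintro (⟨h1, h2, h3, h4⟩ | ⟨rfl, rfl⟩)
      · exact ⟨h1, h2, by omega, h4⟩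
      · refine ⟨by omega, by omega, le_rfl, side a l h.left, ?_, ?_⟩
        · have := side _ r h.right
          rwa [show a + l.numNodes + 1 + r.numNodes + 1 =
            a + (l.numNodes + r.numNodes + 1) + 1 by omega] at this
        · simpa using side a _ h

theorem fanSeq_of_le {E : Finset (ℕ × ℕ)} {a b : ℕ} (h : b ≤ a + 1) : fanSeq E a b = [] := by
  rw [fanSeq, if_pos h]

theorem fanSeq_of_lt {E : Finset (ℕ × ℕ)} {a b : ℕ} (h : a + 1 < b) :
    fanSeq E a b = fan E a b :: (fan E a b).flatMap fun p => fanSeq E p.1 p.2 := by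
  rw [fanSeq, if_neg (by omega)]
  congr 1
  rw [List.flatMap_subtype (g := fun p => fanSeq E p.1 p.2) (fun _ _ => rfl), List.unattach_attach]

theorem map_length_fanSeq {E : Finset (ℕ × ℕ)} {a : ℕ} {t : BinaryTree Unit}
    (h : Represents E a t) :
    (fanSeq E a (a + t.numNodes + 1)).map List.length = runs t := by
  induction t generalizing a with
  | nil => rw [fanSeq_of_le (by simp)]; rfl
  | node v l r hl hr =>
    have hl := hl h.left
    have hr := hr h.right
    rw [show a + l.numNodes + 1 + r.numNodes + 1 =
      a + (l.numNodes + r.numNodes + 1) + 1 by omega] at hr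
    rw [BinaryTree.numNodes, fanSeq_of_lt (by omega), fan_node h, runs, ← hl]
    -- If the left part is an edge, its sequence of fans is empty and the root triangle starts a new
    -- fan of size one, matching `bump [] = [1]`.
    by_cases hl0 : l.numNodes = 0
    · have hfan : fan E a (a + l.numNodes + 1) = [] := by
        refine List.eq_nil_iff_forall_not_mem.mpr fun p hp => ?_
        rw [mem_fan] at hp
        omega
      rw [hfan, fanSeq_of_le (by omega)]
      simp [hr]
    · rw [fanSeq_of_lt (by omega)]
      simp [bump, hr]

theorem encard_Tri (n t : ℕ) (s : ℤ) (hn : 3 ≤ n) :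
    (Tri n t s).encard = (longTrees (n - 2) t s).encard := by
  have key : Tri n t s = diagonals '' longTrees (n - 2) t s := by
    ext D
    simp only [Tri, Set.mem_ofPred_eq, Set.mem_image, longTrees, isTriangulation_iff hn]
    have main (τ : BinaryTree Unit) (hτ : τ.numNodes + 2 = n) :
        ((((fanDecomposition n (diagonals τ)).length : ℤ) = s + t ∧
          ((fanDecomposition n (diagonals τ)).countP (fun F => F.length = 1) : ℤ) = s ∧
          ∃ F, (fanDecomposition n (diagonals τ)).getLast? = some F ∧ F.length ≠ 1) ↔
        ((runs τ).countP (fun k => 2 ≤ k) = t ∧ ((runs τ).count 1 : ℤ) = s ∧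
          (runs τ = [] ∨ EndsLong (runs τ)))) := by
      have hr := map_length_fanSeq (represents_edges (t := τ) (by omega))
      rw [show 1 + τ.numNodes + 1 = n by omega, show τ.numNodes + 2 = n by omega] at hr
      change (fanDecomposition n (diagonals τ)).map List.length = runs τ at hr
      have hpos := runs_pos τ
      have hne : runs τ ≠ [] := by
        rw [Ne, runs_eq_nil]
        rintro rfl
        simp at hτ; omega
      have hlen : (fanDecomposition n (diagonals τ)).length = (runs τ).length := by
        rw [← hr, List.length_map]
      have hone : (fanDecomposition n (diagonals τ)).countP (fun F => F.length = 1) =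
          (runs τ).count 1 := by
        rw [← hr, List.count, List.countP_map]
        rfl
      -- Since all runs are positive, `s + t` fans with `s` singular ones means exactly `t` long
      -- runs.
      have hsum : (runs τ).length = (runs τ).count 1 + (runs τ).countP (fun k => 2 ≤ k) := by
        rw [List.length_eq_countP_add_countP (· == 1), List.count]
        congr 1
        refine List.countP_congr fun k hk => ?_
        have := hpos k hk
        simp; omega
      have hlast : (∃ F, (fanDecomposition n (diagonals τ)).getLast? = some F ∧ F.length ≠ 1) ↔
          EndsLong (runs τ) := by
        rw [EndsLong]
        constructor
        · rintro ⟨F, hF, hF1⟩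
          have hm : F.length ∈ (runs τ).getLast? := by
            rw [← hr, List.getLast?_map, hF]; rfl
          have := hpos _ (List.mem_of_getLast? hm)
          exact ⟨F.length, hm, by omega⟩
        · rintro ⟨k, hk, hk2⟩
          rw [← hr, List.getLast?_map, Option.mem_def, Option.map_eq_some_iff] at hk
          obtain ⟨F, hF, rfl⟩ := hk
          exact ⟨F, hF, by omega⟩
      rw [hlen, hone, hsum, hlast, or_iff_right hne]
      constructor
      · rintro ⟨h1, h2, h3⟩
        exact ⟨by omega, h2, h3⟩
      · rintro ⟨h1, h2, h3⟩
        exact ⟨by omega, h2, h3⟩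
    constructor
    · rintro ⟨⟨τ, hτ, rfl⟩, h⟩
      exact ⟨τ, ⟨by omega, (main τ hτ).mp h⟩, rfl⟩
    · rintro ⟨τ, ⟨hτ, h⟩, rfl⟩
      exact ⟨⟨τ, by omega, rfl⟩, (main τ (by omega)).mpr h⟩
  rw [key, Set.InjOn.encard_image]
  exact (diagonals_injOn (n - 2) (by omega)).mono fun τ hτ => hτ.1

theorem Tri_eq_empty (n t : ℕ) (s : ℤ) (hn : n < 3) : Tri n t s = ∅ := by
  refine Set.eq_empty_of_forall_notMem fun D hD => ?_
  have := hD.1.1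
  omega

theorem mainTheorem3 :
    (∀ n l s : ℕ,
      (Dyck n l (s : ℤ)).encard = (Dyck n l ((n : ℤ) - (s : ℤ) - 2 * (l : ℤ))).encard) ∧
    (∀ n t s : ℕ,
      (Tri n t (s : ℤ)).encard = (Tri n t ((n : ℤ) - 2 * (t : ℤ) - (s : ℤ) - 2)).encard) := by
  constructor
  · intro n l s
    rw [encard_Dyck, encard_Dyck, encard_longTrees_symm]
  · intro n t s
    by_cases hn : n < 3
    · rw [Tri_eq_empty _ _ _ hn, Tri_eq_empty _ _ _ hn]
    · rw [encard_Tri _ _ _ (by omega), encard_Tri _ _ _ (by omega), encard_longTrees_symm]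
      -- What remains is to match the integer indices; the truncated `n - 2` is harmless as `3 ≤ n`.
      congr 2
      omega
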